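/- Young diagrams are finite sets of boxes $Y=\{(i,j): 1\le i\le k,\ 1\le j\le \lambda_i\}$ with $\lambda_1\ge\dots\ge\lambda_k\ge 0$. The hook of a box $(i,j)\in Y$ consists of $(i,j)$, the boxes $(i',j)\in Y$ with $i'>i$, and the boxes $(i,j')\in Y$ with $j'>j$. Removing this hook from $Y$ means deleting its boxes and then moving every box $(i',j')$ with $i'>i$ and $j'>j$ to $(i'-1,j'-1)$; the result is again a Young diagram, contained in $Y$. For positive integers $m,n$, the impartial game $\mathrm{MHRG}(m,n)$ is defined as follows. The starting position is the rectangle $Y_{m,n}=\{(i,j):1\le i\le m,\ 1\le j\le n\}$, in which the box $(i,j)$ carries the number $\alpha_{m,n}(i,j)=\min\{j-i+m,\ i-j+n\}$; in every position $Y\subseteq Y_{m,n}$ the box at $(i,j)$ carries the number $\alpha_{m,n}(i,j)$. In a position $Y$, the player to move chooses a box of $Y$ and removes its hook $h$; let $\mathcal A(h)$ be the multiset of the numbers in the boxes of $h$. As long as the current diagram has a box whose hook $h'$ satisfies $\mathcal A(h')=\mathcal A(h)$, the player must choose such a box and remove its hook as well; when there is no such box, the turn ends, and the current diagram is passed to the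 other player. The player who makes the empty diagram wins. The positions of $\mathrm{MHRG}(m,n)$ are the diagrams reachable from $Y_{m,n}$ by finitely many (possibly zero) turns. The $\mathcal G$-value of a position $Y$ is defined recursively by $$\mathcal G(Y)=\mathrm{mex}\{\mathcal G(Y') : Y' \text{ can be reached from } Y \text{ in one turn}\},$$ where $\mathrm{mex}\,T=\min(\mathbb Z_{\ge 0}\setminus T)$. Let $n\ge 2$. In $\mathrm{MHRG}(2,n)$, the $\mathcal G$-value of the starting position $Y_{2,n}$ is $$\mathcal G(Y_{2,n})=\begin{cases}3 & \text{if } n\in\{2,3\},\\ 2 & \text{if } n\notin\{2,3\} \text{ and } n\equiv 2 \text{ or } 3 \pmod 8,\\ 1 & \text{otherwise.}\end{cases}$$ -/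

import Mathlib

/-! ## Impartial games and their 𝒢-values -/

/-- An impartial game with a starting position: `Move p q` says that `q` is an option of `p`.
Every position has finitely many options and every play ends. -/
structure ImpartialGame where
  Pos : Type
  Move : Pos → Pos → Prop
  start : Pos
  finite_options : ∀ p, {q | Move p q}.Finite
  wf : WellFounded (fun q p => Move p q)

/-- The minimal excluded natural number of a (proper) subset of `ℕ`. -/
noncomputable def mex (S : Set ℕ) : ℕ := sInf Sᶜ

namespace ImpartialGame

/-- The 𝒢-value of a position: the `mex` of the 𝒢-values of its options. -/
noncomputable def gValue (G : ImpartialGame) : G.Pos → ℕ :=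
  G.wf.fix fun p ih => mex {k | ∃ (q : G.Pos) (h : G.Move p q), ih q h = k}

/-- The defining recursion of the 𝒢-value. -/
theorem gValue_eq (G : ImpartialGame) (p : G.Pos) :
    G.gValue p = mex (G.gValue '' {q | G.Move p q}) := by
  unfold gValue
  rw [WellFounded.fix_eq]
  congr 1
  ext k
  simp [Set.mem_image]

end ImpartialGame

/-! ## Young diagrams, hooks and hook removal

Mathlib's Young diagrams have rows and columns numbered from `0`, so the cell `(i, j)` below is the
box usually called `(i + 1, j + 1)`. -/

namespace HookGame

/-- The hook of the box `c` in `Y`: the box itself, the boxes of `Y` below it in its column, and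
the boxes of `Y` to the right of it in its row. -/
def hook (Y : YoungDiagram) (c : ℕ × ℕ) : Finset (ℕ × ℕ) :=
  Y.cells.filter fun d => d = c ∨ (c.1 < d.1 ∧ d.2 = c.2) ∨ (d.1 = c.1 ∧ c.2 < d.2)

/-- When the hook of `c` is removed, a box strictly below and strictly to the right of `c` moves
one step diagonally to the upper left; the other remaining boxes stay in place. -/
def slide (c d : ℕ × ℕ) : ℕ × ℕ :=
  if c.1 < d.1 ∧ c.2 < d.2 then (d.1 - 1, d.2 - 1) else d

theorem mem_slide_image (Y : YoungDiagram) (c e : ℕ × ℕ) :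
    e ∈ (Y.cells \ hook Y c).image (slide c) ↔
      (e ∈ Y ∧ (e.1 < c.1 ∨ e.2 < c.2)) ∨ (c.1 ≤ e.1 ∧ c.2 ≤ e.2 ∧ (e.1 + 1, e.2 + 1) ∈ Y) := by
  obtain ⟨a, b⟩ := c
  obtain ⟨x, y⟩ := e
  simp only [Finset.mem_image, Finset.mem_sdiff, hook, Finset.mem_filter, YoungDiagram.mem_cells,
    Prod.exists, Prod.mk.injEq, slide]
  constructor
  · rintro ⟨i, j, ⟨hY, hh⟩, hs⟩
    split_ifs at hs with hc
    · obtain ⟨rfl, rfl⟩ := Prod.mk.injEq .. ▸ hs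
      right
      refine ⟨by omega, by omega, ?_⟩
      have h1 : i - 1 + 1 = i := by omega
      have h2 : j - 1 + 1 = j := by omega
      rw [h1, h2]
      exact hY
    · obtain ⟨rfl, rfl⟩ := Prod.mk.injEq .. ▸ hs
      left
      refine ⟨hY, ?_⟩
      by_contra hcon
      apply hh
      refine ⟨hY, ?_⟩
      omega
  · rintro (⟨hY, h⟩ | ⟨h1, h2, hY⟩)
    · refine ⟨x, y, ⟨hY, ?_⟩, ?_⟩
      · rintro ⟨-, h'⟩
        omega
      · rw [if_neg (by omega)]
    · refine ⟨x + 1, y + 1, ⟨hY, ?_⟩, ?_⟩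
      · rintro ⟨-, h'⟩
        omega
      · rw [if_pos (by omega)]
        simp

/-- The Young diagram obtained from `Y` by removing the hook of the box `c`. -/
def removeHook (Y : YoungDiagram) (c : ℕ × ℕ) : YoungDiagram where
  cells := (Y.cells \ hook Y c).image (slide c)
  isLowerSet := by
    rintro ⟨x, y⟩ ⟨u, v⟩ hle h
    rw [Finset.mem_coe, mem_slide_image] at h ⊢
    obtain ⟨hu, hv⟩ := Prod.mk_le_mk.mp hle
    by_cases hc : u < c.1 ∨ v < c.2
    · left
      refine ⟨?_, hc⟩
      rcases h with ⟨hY, -⟩ | ⟨-, -, hY⟩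
      · exact Y.up_left_mem hu hv hY
      · exact Y.up_left_mem (by simp only; omega) (by simp only; omega) hY
    · right
      rcases h with ⟨-, h⟩ | ⟨-, -, hY⟩
      · simp only at h
        omega
      · exact ⟨by simp only; omega, by simp only; omega,
          Y.up_left_mem (by simp only; omega) (by simp only; omega) hY⟩

theorem removeHook_le (Y : YoungDiagram) (c : ℕ × ℕ) : removeHook Y c ≤ Y := by
  rintro ⟨x, y⟩ h
  rcases (mem_slide_image Y c _).mp h with ⟨hY, -⟩ | ⟨-, -, hY⟩
  · exact hY
  · exact Y.up_left_mem (by simp only; omega) (by simp only; omega) hY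

theorem card_removeHook_lt {Y : YoungDiagram} {c : ℕ × ℕ} (hc : c ∈ Y) :
    (removeHook Y c).card < Y.card := by
  refine lt_of_le_of_lt Finset.card_image_le (Finset.card_lt_card ?_)
  refine Finset.sdiff_ssubset (Finset.filter_subset _ _) ⟨c, ?_⟩
  simp [hook, hc]

/-! ## The rules of the Multiple Hook Removing Game

A numbering is given as a function `α : ℕ × ℕ → ℕ`; the game started at `Y` only reads its values
on the boxes of `Y`. -/

/-- The multiset of the numbers in the hook of the box `c` of `Y`. -/
def hookNumbers (α : ℕ × ℕ → ℕ) (Y : YoungDiagram) (c : ℕ × ℕ) : Multiset ℕ :=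
  (hook Y c).val.map α

/-- `Continuation α A Y Z`: while some hook has the multiset of numbers `A`, one such hook has to be
removed; starting at `Y`, this can lead to `Z`, where no hook with multiset `A` is left. -/
inductive Continuation (α : ℕ × ℕ → ℕ) (A : Multiset ℕ) : YoungDiagram → YoungDiagram → Prop
  | done (Y : YoungDiagram) (h : ∀ c ∈ Y, hookNumbers α Y c ≠ A) : Continuation α A Y Y
  | step (Y Z : YoungDiagram) (c : ℕ × ℕ) (hc : c ∈ Y) (hA : hookNumbers α Y c = A)
      (h : Continuation α A (removeHook Y c) Z) : Continuation α A Y Z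

/-- A complete turn leading from `Y` to `Z`: the player chooses a box of `Y`, removes its hook, and
then keeps removing hooks with the same multiset of numbers as long as there are any. -/
def Turn (α : ℕ × ℕ → ℕ) (Y Z : YoungDiagram) : Prop :=
  ∃ c ∈ Y, Continuation α (hookNumbers α Y c) (removeHook Y c) Z

theorem Continuation.le {α : ℕ × ℕ → ℕ} {A : Multiset ℕ} {Y Z : YoungDiagram}
    (h : Continuation α A Y Z) : Z ≤ Y := by
  induction h with
  | done Y h => exact le_rfl
  | step Y Z c hc hA h ih => exact ih.trans (removeHook_le Y c)

theorem Turn.le {α : ℕ × ℕ → ℕ} {Y Z : YoungDiagram} (h : Turn α Y Z) : Z ≤ Y := by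
  obtain ⟨c, -, h⟩ := h
  exact h.le.trans (removeHook_le Y c)

theorem Turn.card_lt {α : ℕ × ℕ → ℕ} {Y Z : YoungDiagram} (h : Turn α Y Z) : Z.card < Y.card := by
  obtain ⟨c, hc, h⟩ := h
  exact lt_of_le_of_lt (Finset.card_le_card h.le) (card_removeHook_lt hc)

/-- The Multiple Hook Removing Game with starting position `Ys`, numbered by `α`. Its positions are
the Young diagrams that can be reached from `Ys` by a sequence of turns. -/
def game (Ys : YoungDiagram) (α : ℕ × ℕ → ℕ) : ImpartialGame where
  Pos := {Y : YoungDiagram // Relation.ReflTransGen (Turn α) Ys Y}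
  Move := fun Y Z => Turn α Y.1 Z.1
  start := ⟨Ys, Relation.ReflTransGen.refl⟩
  finite_options := by
    rintro ⟨Y, -⟩
    refine Set.Finite.of_finite_image
      (f := fun Z : {Y : YoungDiagram // Relation.ReflTransGen (Turn α) Ys Y} => Z.1.cells)
      ((Y.cells.powerset.finite_toSet).subset ?_) ?_
    · rintro _ ⟨Z, hZ, rfl⟩
      exact Finset.mem_coe.mpr (Finset.mem_powerset.mpr (Turn.le hZ))
    · intro Z _ Z' _ h
      exact Subtype.ext (YoungDiagram.ext h)
  wf := Subrelation.wf (fun h => Turn.card_lt h)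
    (InvImage.wf (fun Y : {Y : YoungDiagram // Relation.ReflTransGen (Turn α) Ys Y} => Y.1.card)
      Nat.lt_wfRel.wf)

/-! ## Rectangles with the unimodal numbering -/

/-- The rectangular Young diagram with `m` rows and `n` columns. -/
def rectangle (m n : ℕ) : YoungDiagram where
  cells := Finset.range m ×ˢ Finset.range n
  isLowerSet := by
    rintro ⟨x, y⟩ ⟨u, v⟩ hle h
    obtain ⟨hu, hv⟩ := Prod.mk_le_mk.mp hle
    simp only [Finset.coe_product, Finset.coe_range, Set.mem_prod, Set.mem_Iio] at h ⊢
    omega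

/-- The unimodal numbering `(i, j) ↦ min (j - i + m) (i - j + n)` of the boxes of the `m × n`
rectangle. -/
def unimodal (m n : ℕ) (c : ℕ × ℕ) : ℕ := min (c.2 + m - c.1) (c.1 + n - c.2)

/-- On the rectangle, no subtraction in `unimodal` is truncated, and the numbers are positive. -/
theorem unimodal_spec {m n : ℕ} {c : ℕ × ℕ} (hc : c ∈ rectangle m n) :
    (unimodal m n c : ℤ) = min ((c.2 : ℤ) - c.1 + m) ((c.1 : ℤ) - c.2 + n) ∧
      0 < unimodal m n c := by
  have h : c.1 < m ∧ c.2 < n := by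
    have h' : c ∈ Finset.range m ×ˢ Finset.range n := hc
    simpa using h'
  unfold unimodal
  omega

end HookGame

/-- The game MHRG(m, n): the Multiple Hook Removing Game whose starting position is the `m × n`
rectangle with the unimodal numbering. -/
def MHRG (m n : ℕ) : ImpartialGame :=
  HookGame.game (HookGame.rectangle m n) (HookGame.unimodal m n)

/-!
A diagram with at most two rows is determined by the set `{x, y}` of its two first-column hook
lengths (with an empty row counted), and removing a hook replaces one element of the set by a
smaller one. The hook of a box is equidistributed with a strip along the rim, whose contents form
an interval, and the unimodal numbering takes the same multiset of values on two intervals of the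
same length only if they are equal or mirror images of each other. Hence, in the reachable diagrams,
a turn either lowers one of `x`, `y` or reflects both in the point `(n + 1) / 2`, and this point and
mirror-image pairs are avoided. Skipping the centre leaves a game on pairs in `{0, …, 2k - 1}` with
`k = n / 2 + 1`.

Below the antidiagonal `x + y = 2k - 1` the pair game is Welter's game with the pairs of sum
`2k - 1` removed, which does not affect the value `(x xor y) - 1`. Above it, the positions of
value `0`, `1` and `2` are found one after the other, as the independent absorbing sets among the
positions that do not have a smaller value; the value of the corner `(2k - 1, 2k - 2)` can be read
off.
-/

theorem mex_eq_iff {S : Set ℕ} (hS : S.Finite) {v : ℕ} :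
    mex S = v ↔ v ∉ S ∧ ∀ u < v, u ∈ S := by
  have hmex : mex S ∉ S := Nat.sInf_mem hS.infinite_compl.nonempty
  have hlt : ∀ u < mex S, u ∈ S := fun u hu => not_not.1 (Nat.notMem_of_lt_sInf hu)
  constructor
  · rintro rfl
    exact ⟨hmex, hlt⟩
  · rintro ⟨hv, hltv⟩
    exact le_antisymm (not_lt.1 fun h => hv (hlt v h)) (not_lt.1 fun h => hmex (hltv _ h))

namespace ImpartialGame

variable {G : ImpartialGame}

theorem gValue_eq_iff {p : G.Pos} {v : ℕ} :
    G.gValue p = v ↔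
      (∀ q, G.Move p q → G.gValue q ≠ v) ∧ ∀ u < v, ∃ q, G.Move p q ∧ G.gValue q = u := by
  rw [gValue_eq, mex_eq_iff ((G.finite_options p).image _)]
  simp only [Set.mem_image, Set.mem_ofPred_eq, not_exists, not_and, ne_eq]

theorem gValue_ne_of_move {p q : G.Pos} (h : G.Move p q) : G.gValue q ≠ G.gValue p :=
  (gValue_eq_iff.1 rfl).1 q h

theorem exists_move_gValue_eq {p : G.Pos} {v : ℕ} (hv : v < G.gValue p) :
    ∃ q, G.Move p q ∧ G.gValue q = v :=
  (gValue_eq_iff.1 rfl).2 v hv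

theorem gValue_eq_of_bisimulation {H : ImpartialGame} (R : G.Pos → H.Pos → Prop)
    (forth : ∀ p q p', R p q → G.Move p p' → ∃ q', H.Move q q' ∧ R p' q')
    (back : ∀ p q q', R p q → H.Move q q' → ∃ p', G.Move p p' ∧ R p' q')
    {p : G.Pos} {q : H.Pos} (h : R p q) : G.gValue p = H.gValue q := by
  induction p using G.wf.induction generalizing q with
  | _ p ih =>
    rw [gValue_eq, gValue_eq]
    congr 1
    ext v
    constructor
    · rintro ⟨p', hp', rfl⟩
      obtain ⟨q', hq', h'⟩ := forth p q p' h hp'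
      exact ⟨q', hq', (ih p' hp' h').symm⟩
    · rintro ⟨q', hq', rfl⟩
      obtain ⟨p', hp', h'⟩ := back p q q' h hq'
      exact ⟨p', hp', ih p' hp' h'⟩

-- Among the positions of value at least `v`, those of value `v` form the unique kernel.
theorem gValue_eq_iff_mem_of_kernel {v : ℕ} {L S : Set G.Pos}
    (hL : ∀ p ∈ L, G.gValue p = v ↔ p ∈ S)
    (hle : ∀ p ∉ L, p ∈ S → v ≤ G.gValue p)
    (hindep : ∀ p ∉ L, p ∈ S → ∀ q, G.Move p q → q ∉ S)
    (habs : ∀ p ∉ L, p ∉ S → v ≤ G.gValue p → ∃ q, G.Move p q ∧ q ∈ S) (p : G.Pos) :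
    G.gValue p = v ↔ p ∈ S := by
  induction p using G.wf.induction with
  | _ p ih =>
    by_cases hpL : p ∈ L
    · exact hL p hpL
    constructor
    · intro hpv
      by_contra hpS
      obtain ⟨q, hpq, hqS⟩ := habs p hpL hpS hpv.ge
      exact gValue_ne_of_move hpq (((ih q hpq).2 hqS).trans hpv.symm)
    · intro hpS
      by_contra hpv
      obtain ⟨q, hpq, hqv⟩ := exists_move_gValue_eq ((hle p hpL hpS).lt_of_ne' hpv)
      exact hindep p hpL hpS q hpq ((ih q hpq).1 hqv)

end ImpartialGame

namespace HookGame

/-! ### Hooks of two-row diagrams -/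

/-- The numbers on a rim strip whose boxes have the contents `t, …, s - 1`, in the rectangle with
`m` rows and `n` columns, `m + n = M + 1`. Contents are shifted so that they run from `0` to `M - 1`
in the rectangle: the content of the box `(i, j)` is `j - i + m - 1`. -/
def segment (M t s : ℕ) : Multiset ℕ := (Finset.Ico t s).val.map fun e => min (e + 1) (M - e)

section Segment

variable {M t s t' s' : ℕ}

theorem mem_segment {a : ℕ} :
    a ∈ segment M t s ↔ ∃ e, (t ≤ e ∧ e < s) ∧ min (e + 1) (M - e) = a := by
  simp only [segment, Multiset.mem_map, Finset.mem_val, Finset.mem_Ico]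

theorem segment_reflect (hs : s ≤ M) : segment M (M - s) (M - t) = segment M t s := by
  have himage : (Finset.Ico t s).image (M - 1 - ·) = Finset.Ico (M - s) (M - t) := by
    ext e
    simp only [Finset.mem_image, Finset.mem_Ico]
    exact ⟨by omega, fun h => ⟨M - 1 - e, by omega⟩⟩
  have hinj : Set.InjOn (M - 1 - ·) (Finset.Ico t s : Set ℕ) := by
    intro a ha b hb
    rw [Finset.coe_Ico, Set.mem_Ico] at ha hb
    dsimp only
    omega
  rw [segment, ← himage, Finset.image_val_of_injOn hinj, Multiset.map_map]
  refine Multiset.map_congr rfl fun e he => ?_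
  rw [Finset.mem_val, Finset.mem_Ico] at he
  dsimp only [Function.comp_apply]
  omega

theorem isLeast_segment (hts : t < s) (hs : s ≤ M) :
    IsLeast {a | a ∈ segment M t s} (min (t + 1) (M + 1 - s)) := by
  refine ⟨mem_segment.2 ?_, fun a ha => ?_⟩
  · by_cases h : t + s ≤ M
    · exact ⟨t, by omega⟩
    · exact ⟨s - 1, by omega⟩
  · obtain ⟨e, he, rfl⟩ := mem_segment.1 ha
    omega

-- The number `s - t` of elements and the least element give the ends up to reflection.
theorem segment_eq_segment_iff (hts : t < s) (hs : s ≤ M) (hts' : t' < s') (hs' : s' ≤ M) :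
    segment M t s = segment M t' s' ↔ (t = t' ∧ s = s') ∨ (t + s' = M ∧ s + t' = M) := by
  constructor
  · intro h
    have hcard : s - t = s' - t' := by
      simpa only [segment, Multiset.card_map, Finset.card_val, Nat.card_Ico] using
        congrArg Multiset.card h
    have hleast := (isLeast_segment hts hs).unique (h ▸ isLeast_segment hts' hs')
    omega
  · rintro (⟨rfl, rfl⟩ | ⟨h1, h2⟩)
    · rfl
    · rw [← segment_reflect hs', show M - s' = t by omega, show M - t' = s by omega]

end Segment

section Hooks

variable {Y : YoungDiagram} {i j i' j' : ℕ}

theorem mk_mem_hook_iff (h : (i, j) ∈ Y) : (i', j') ∈ hook Y (i, j) ↔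
    (j' = j ∧ i ≤ i' ∧ i' < Y.colLen j) ∨ (i' = i ∧ j ≤ j' ∧ j' < Y.rowLen i) := by
  have hi := YoungDiagram.mem_iff_lt_colLen.1 h
  have hj := YoungDiagram.mem_iff_lt_rowLen.1 h
  rw [hook, Finset.mem_filter, YoungDiagram.mem_cells, Prod.mk.injEq]
  constructor
  · rintro ⟨hY, ⟨rfl, rfl⟩ | ⟨hlt, rfl⟩ | ⟨rfl, hlt⟩⟩
    · exact Or.inl ⟨rfl, le_rfl, hi⟩
    · exact Or.inl ⟨rfl, hlt.le, YoungDiagram.mem_iff_lt_colLen.1 hY⟩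
    · exact Or.inr ⟨rfl, hlt.le, YoungDiagram.mem_iff_lt_rowLen.1 hY⟩
  · rintro (⟨rfl, hle, hlt⟩ | ⟨rfl, hle, hlt⟩)
    · exact ⟨YoungDiagram.mem_iff_lt_colLen.2 hlt, by omega⟩
    · exact ⟨YoungDiagram.mem_iff_lt_rowLen.2 hlt, by omega⟩

-- The contents go up by one in each step along the hook.
theorem hookNumbers_unimodal {m : ℕ} (n : ℕ) (hm : Y.colLen 0 ≤ m) (h : (i, j) ∈ Y) :
    hookNumbers (unimodal m n) Y (i, j) =
      segment (m + n - 1) (j + m - Y.colLen j) (Y.rowLen i + m - 1 - i) := by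
  have hi := YoungDiagram.mem_iff_lt_colLen.1 h
  have hj := YoungDiagram.mem_iff_lt_rowLen.1 h
  have hcol : Y.colLen j ≤ m := (Y.colLen_anti 0 j j.zero_le).trans hm
  let content (c : ℕ × ℕ) : ℕ := c.2 + (m - 1) - c.1
  have himage : (hook Y (i, j)).image content =
      Finset.Ico (j + m - Y.colLen j) (Y.rowLen i + m - 1 - i) := by
    ext e
    simp only [Finset.mem_image, Prod.exists, mk_mem_hook_iff h, Finset.mem_Ico, content]
    refine ⟨by omega, fun he => ?_⟩
    by_cases hle : e + i ≤ j + (m - 1)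
    · exact ⟨j + (m - 1) - e, j, by omega⟩
    · exact ⟨i, e + i - (m - 1), by omega⟩
  have hinj : Set.InjOn content (hook Y (i, j) : Set (ℕ × ℕ)) := by
    rintro ⟨a, b⟩ hab ⟨a', b'⟩ hab' heq
    rw [Finset.mem_coe, mk_mem_hook_iff h] at hab hab'
    rw [Prod.mk.injEq]
    dsimp only [content] at heq
    omega
  rw [hookNumbers, segment, ← himage, Finset.image_val_of_injOn hinj, Multiset.map_map]
  refine Multiset.map_congr rfl fun ⟨a, b⟩ hab => ?_
  rw [Finset.mem_val, mk_mem_hook_iff h] at hab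
  dsimp only [Function.comp_apply, unimodal, content]
  omega

theorem mk_mem_removeHook_iff : (i', j') ∈ removeHook Y (i, j) ↔
    ((i', j') ∈ Y ∧ (i' < i ∨ j' < j)) ∨ (i ≤ i' ∧ j ≤ j' ∧ (i' + 1, j' + 1) ∈ Y) :=
  mem_slide_image Y (i, j) (i', j')

theorem continuation_iff {α : ℕ × ℕ → ℕ} {A : Multiset ℕ} {Z : YoungDiagram} :
    Continuation α A Y Z ↔ ((∀ c ∈ Y, hookNumbers α Y c ≠ A) ∧ Z = Y) ∨
      ∃ c ∈ Y, hookNumbers α Y c = A ∧ Continuation α A (removeHook Y c) Z := by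
  constructor
  · rintro (⟨_, h⟩ | ⟨_, _, c, hc, hA, h⟩)
    · exact Or.inl ⟨h, rfl⟩
    · exact Or.inr ⟨c, hc, hA, h⟩
  · rintro (⟨h, rfl⟩ | ⟨c, hc, hA, h⟩)
    · exact .done _ h
    · exact .step _ _ c hc hA h

end Hooks

theorem mk_mem_rectangle_iff {m n i j : ℕ} : (i, j) ∈ rectangle m n ↔ i < m ∧ j < n := by
  rw [← YoungDiagram.mem_cells]
  simp only [rectangle, Finset.mem_product, Finset.mem_range]

/-- The diagram with at most two rows whose first column hook lengths (the beta-set of the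
partition) are `x ≠ y`; the larger one exceeds its row length by one. -/
def twoRow (x y : ℕ) : YoungDiagram := rectangle 1 (max x y - 1) ⊔ rectangle 2 (min x y)

section TwoRow

variable {n x y : ℕ}

theorem mk_mem_twoRow_iff {i j : ℕ} :
    (i, j) ∈ twoRow x y ↔ (i = 0 ∧ j + 1 < max x y) ∨ (i < 2 ∧ j < min x y) := by
  rw [twoRow, YoungDiagram.mem_sup, mk_mem_rectangle_iff, mk_mem_rectangle_iff]
  omega

theorem twoRow_comm (x y : ℕ) : twoRow x y = twoRow y x := by
  rw [twoRow, twoRow, max_comm, min_comm]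

theorem rectangle_two_eq_twoRow (n : ℕ) : rectangle 2 n = twoRow (n + 1) n := by
  ext ⟨i, j⟩
  rw [YoungDiagram.mem_cells, YoungDiagram.mem_cells, mk_mem_rectangle_iff, mk_mem_twoRow_iff]
  omega

theorem colLen_twoRow (hxy : y < x) (j : ℕ) :
    (twoRow x y).colLen j = if j < y then 2 else if j + 1 < x then 1 else 0 := by
  refine eq_of_forall_lt_iff fun i => ?_
  rw [← YoungDiagram.mem_iff_lt_colLen, mk_mem_twoRow_iff]
  split_ifs <;> omega

theorem rowLen_zero_twoRow (hxy : y < x) : (twoRow x y).rowLen 0 = x - 1 := by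
  refine eq_of_forall_lt_iff fun j => ?_
  rw [← YoungDiagram.mem_iff_lt_rowLen, mk_mem_twoRow_iff]
  omega

theorem rowLen_one_twoRow (x y : ℕ) : (twoRow x y).rowLen 1 = min x y := by
  refine eq_of_forall_lt_iff fun j => ?_
  rw [← YoungDiagram.mem_iff_lt_rowLen, mk_mem_twoRow_iff]
  omega

theorem hookNumbers_twoRow (n : ℕ) (hxy : y < x) {i j : ℕ} (h : (i, j) ∈ twoRow x y) :
    hookNumbers (unimodal 2 n) (twoRow x y) (i, j) =
      segment (n + 1) (if j < y then j else j + 1) (if i = 0 then x else y) := by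
  have hcol := colLen_twoRow hxy
  have hrow₀ := rowLen_zero_twoRow hxy
  have hrow₁ := rowLen_one_twoRow x y
  rw [hookNumbers_unimodal n (by grind) h]
  rw [mk_mem_twoRow_iff] at h
  congr 1 <;> grind

theorem removeHook_twoRow (hxy : y < x) {i j : ℕ} (h : (i, j) ∈ twoRow x y) :
    removeHook (twoRow x y) (i, j) =
      twoRow (if i = 0 then y else x) (if j < y then j else j + 1) := by
  rw [mk_mem_twoRow_iff] at h
  ext ⟨a, b⟩
  simp only [YoungDiagram.mem_cells, mk_mem_removeHook_iff, mk_mem_twoRow_iff]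
  grind

theorem exists_hook_twoRow_iff (n : ℕ) (hxy : x ≠ y) (P : Multiset ℕ → YoungDiagram → Prop) :
    (∃ c ∈ twoRow x y,
      P (hookNumbers (unimodal 2 n) (twoRow x y) c) (removeHook (twoRow x y) c)) ↔
    (∃ t < x, t ≠ y ∧ P (segment (n + 1) t x) (twoRow t y)) ∨
      ∃ t < y, t ≠ x ∧ P (segment (n + 1) t y) (twoRow x t) := by
  wlog hlt : y < x generalizing x y
  · simpa only [twoRow_comm y, or_comm, twoRow_comm _ x] using this hxy.symm (by omega)
  constructor
  · rintro ⟨⟨i, j⟩, hc, hP⟩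
    rw [hookNumbers_twoRow n hlt hc, removeHook_twoRow hlt hc] at hP
    rw [mk_mem_twoRow_iff] at hc
    by_cases hi : i = 0
    · rw [if_pos hi, if_pos hi, twoRow_comm] at hP
      exact Or.inl ⟨_, by grind, by grind, hP⟩
    · rw [if_neg hi, if_neg hi] at hP
      exact Or.inr ⟨_, by grind, by grind, hP⟩
  · rintro (⟨t, htx, hty, hP⟩ | ⟨t, hty, -, hP⟩)
    · have hc : (0, if t < y then t else t - 1) ∈ twoRow x y := mk_mem_twoRow_iff.2 (by grind)
      refine ⟨_, hc, ?_⟩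
      rw [hookNumbers_twoRow n hlt hc, removeHook_twoRow hlt hc, twoRow_comm]
      convert hP using 2 <;> grind
    · have hc : (1, t) ∈ twoRow x y := mk_mem_twoRow_iff.2 (by omega)
      refine ⟨_, hc, ?_⟩
      rwa [hookNumbers_twoRow n hlt hc, removeHook_twoRow hlt hc, if_neg one_ne_zero,
        if_neg one_ne_zero, if_pos hty]

end TwoRow

/-! ### Turns on two-row diagrams -/

/-- The pairs of first column hook lengths of the two-row diagrams that occur as positions, for
`M = n + 1`: the conditions besides `x ≠ y` say that no number is its own mirror image under
`x ↦ M - x`, nor that of the other. -/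
def Admissible (M x y : ℕ) : Prop :=
  x ≠ y ∧ x ≤ M ∧ y ≤ M ∧ x + y ≠ M ∧ 2 * x ≠ M ∧ 2 * y ≠ M

section Turns

variable {n x y t s : ℕ} {Z : YoungDiagram}

theorem admissible_comm : Admissible n x y ↔ Admissible n y x := by
  unfold Admissible
  omega

theorem exists_hook_eq_segment_iff (hxy : x ≠ y) (hx : x ≤ n + 1) (hy : y ≤ n + 1) (hts : t < s)
    (hs : s ≤ n + 1) (hxs : x ≠ s) (hys : y ≠ s) (Q : YoungDiagram → Prop) :
    (∃ c ∈ twoRow x y,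
      hookNumbers (unimodal 2 n) (twoRow x y) c = segment (n + 1) t s ∧
        Q (removeHook (twoRow x y) c)) ↔
    (x + t = n + 1 ∧ y + s ≠ n + 1 ∧ Q (twoRow (n + 1 - s) y)) ∨
      (y + t = n + 1 ∧ x + s ≠ n + 1 ∧ Q (twoRow x (n + 1 - s))) := by
  have heq {u z : ℕ} (hu : u < z) (hz : z ≤ n + 1) (hzs : z ≠ s) :
      segment (n + 1) u z = segment (n + 1) t s ↔ z + t = n + 1 ∧ u = n + 1 - s := by
    rw [segment_eq_segment_iff hu hz hts hs]
    omega
  rw [exists_hook_twoRow_iff n hxy fun A W => A = segment (n + 1) t s ∧ Q W]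
  refine or_congr ⟨?_, ?_⟩ ⟨?_, ?_⟩
  · rintro ⟨u, hu, hne, h, hQ⟩
    obtain ⟨hxt, rfl⟩ := (heq hu hx hxs).1 h
    exact ⟨hxt, by omega, hQ⟩
  · rintro ⟨hxt, hne, hQ⟩
    have hu : n + 1 - s < x := by omega
    exact ⟨n + 1 - s, hu, by omega, (heq hu hx hxs).2 ⟨hxt, rfl⟩, hQ⟩
  · rintro ⟨u, hu, hne, h, hQ⟩
    obtain ⟨hyt, rfl⟩ := (heq hu hy hys).1 h
    exact ⟨hyt, by omega, hQ⟩
  · rintro ⟨hyt, hne, hQ⟩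
    have hu : n + 1 - s < y := by omega
    exact ⟨n + 1 - s, hu, by omega, (heq hu hy hys).2 ⟨hyt, rfl⟩, hQ⟩

theorem continuation_twoRow_iff (hxy : x ≠ y) (hx : x ≤ n + 1) (hy : y ≤ n + 1) (hts : t < s)
    (hs : s ≤ n + 1) (hxs : x ≠ s) (hys : y ≠ s) :
    Continuation (unimodal 2 n) (segment (n + 1) t s) (twoRow x y) Z ↔
      (((x + t = n + 1 → y + s = n + 1) ∧ (y + t = n + 1 → x + s = n + 1)) ∧ Z = twoRow x y) ∨
      (x + t = n + 1 ∧ y + s ≠ n + 1 ∧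
        Continuation (unimodal 2 n) (segment (n + 1) t s) (twoRow (n + 1 - s) y) Z) ∨
      (y + t = n + 1 ∧ x + s ≠ n + 1 ∧
        Continuation (unimodal 2 n) (segment (n + 1) t s) (twoRow x (n + 1 - s)) Z) := by
  have hnone := exists_hook_eq_segment_iff hxy hx hy hts hs hxs hys fun _ => True
  simp only [and_true] at hnone
  rw [continuation_iff, exists_hook_eq_segment_iff hxy hx hy hts hs hxs hys fun W =>
    Continuation (unimodal 2 n) (segment (n + 1) t s) W Z]
  refine or_congr_left (and_congr_left' ?_)
  simp only [ne_eq, ← not_and, ← not_exists, hnone]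
  tauto

theorem continuation_replace_iff (h : Admissible (n + 1) x y) (ht : t < x) (hty : t ≠ y) :
    Continuation (unimodal 2 n) (segment (n + 1) t x) (twoRow t y) Z ↔
      Z = if 2 * t = n + 1 then twoRow (n + 1 - x) y
        else if t + y = n + 1 then twoRow (n + 1 - x) (n + 1 - y) else twoRow t y := by
  obtain ⟨hxy, hx, hy, hadd, hx2, hy2⟩ := h
  rw [continuation_twoRow_iff hty (by omega) hy ht hx ht.ne hxy.symm]
  split_ifs with hmid hrefl
  · rw [continuation_twoRow_iff (x := n + 1 - x) (by omega) (by omega) hy ht hx (by omega)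
      hxy.symm]
    grind
  · rw [show n + 1 - y = t by omega, twoRow_comm _ t,
      continuation_twoRow_iff (x := t) (y := n + 1 - x) (by omega) (by omega) (by omega) ht hx
        ht.ne (by omega)]
    grind
  · grind

theorem exists_continuation_iff (h : Admissible (n + 1) x y) :
    (∃ t < x, t ≠ y ∧ Continuation (unimodal 2 n) (segment (n + 1) t x) (twoRow t y) Z) ↔
      (∃ t < x, Admissible (n + 1) t y ∧ Z = twoRow t y) ∨
        (n + 1 < x + y ∧ Z = twoRow (n + 1 - x) (n + 1 - y)) := by
  obtain ⟨hxy, hx, hy, hadd, hx2, hy2⟩ := id h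
  constructor
  · rintro ⟨t, ht, hty, hZ⟩
    rw [continuation_replace_iff h ht hty] at hZ
    split_ifs at hZ with hmid hrefl
    · exact Or.inl ⟨n + 1 - x, by omega, by unfold Admissible; omega, hZ⟩
    · exact Or.inr ⟨by omega, hZ⟩
    · exact Or.inl ⟨t, ht, by unfold Admissible; omega, hZ⟩
  · rintro (⟨t, ht, hadm, rfl⟩ | ⟨hlt, rfl⟩)
    · obtain ⟨hty, -, -, hadd', ht2, -⟩ := hadm
      exact ⟨t, ht, hty, by rw [continuation_replace_iff h ht hty, if_neg ht2, if_neg hadd']⟩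
    · have ht : n + 1 - y < x := by omega
      have hty : n + 1 - y ≠ y := by omega
      refine ⟨n + 1 - y, ht, hty, ?_⟩
      rw [continuation_replace_iff h ht hty, if_neg (by omega), if_pos (by omega)]

theorem turn_twoRow_iff (h : Admissible (n + 1) x y) :
    Turn (unimodal 2 n) (twoRow x y) Z ↔
      (∃ t < x, Admissible (n + 1) t y ∧ Z = twoRow t y) ∨
        (∃ t < y, Admissible (n + 1) x t ∧ Z = twoRow x t) ∨
          (n + 1 < x + y ∧ Z = twoRow (n + 1 - x) (n + 1 - y)) := by
  have hsnd := exists_continuation_iff (Z := Z) (admissible_comm.1 h)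
  simp only [twoRow_comm _ x, twoRow_comm (n + 1 - y), add_comm y, admissible_comm (y := x)] at hsnd
  rw [Turn, exists_hook_twoRow_iff n h.1 fun A W => Continuation (unimodal 2 n) A W Z,
    exists_continuation_iff h, hsnd, ← or_or_distrib_right, or_assoc]

end Turns

end HookGame

/-! ### The pair game -/

theorem xor_eq_iff_of_lt_two_pow {m c : ℕ} (hc : c < 2 ^ m) (x y : ℕ) :
    x ^^^ y = c ↔ x / 2 ^ m = y / 2 ^ m ∧ x % 2 ^ m ^^^ y % 2 ^ m = c := by
  rw [← Nat.xor_mod_two_pow, ← Nat.xor_eq_zero_iff (x := x / _), ← Nat.xor_div_two_pow]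
  refine ⟨?_, fun ⟨hdiv, hmod⟩ => ?_⟩
  · rintro rfl
    exact ⟨Nat.div_eq_of_lt hc, Nat.mod_eq_of_lt hc⟩
  · rw [← Nat.div_add_mod (x ^^^ y) (2 ^ m), hdiv, hmod, mul_zero, zero_add]

theorem xor_eq_one_iff {x y : ℕ} (h : y < x) : x ^^^ y = 1 ↔ x = y + 1 ∧ y % 2 = 0 := by
  have hmod : ∀ a < 2 ^ 1, ∀ b < 2 ^ 1, a ^^^ b = 1 ↔ a ≠ b := by decide
  rw [xor_eq_iff_of_lt_two_pow (m := 1) (by norm_num),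
    hmod _ (Nat.mod_lt _ (by norm_num)) _ (Nat.mod_lt _ (by norm_num))]
  omega

theorem xor_eq_two_iff {x y : ℕ} (h : y < x) : x ^^^ y = 2 ↔ x = y + 2 ∧ y % 4 < 2 := by
  have hmod : ∀ a < 2 ^ 2, ∀ b < 2 ^ 2, a ^^^ b = 2 ↔ a = b + 2 ∨ b = a + 2 := by decide
  rw [xor_eq_iff_of_lt_two_pow (m := 2) (by norm_num),
    hmod _ (Nat.mod_lt _ (by norm_num)) _ (Nat.mod_lt _ (by norm_num))]
  omega

theorem xor_eq_three_iff {x y : ℕ} (h : y < x) :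
    x ^^^ y = 3 ↔ (x = y + 3 ∧ y % 4 = 0) ∨ (x = y + 1 ∧ y % 4 = 1) := by
  have hmod : ∀ a < 2 ^ 2, ∀ b < 2 ^ 2, a ^^^ b = 3 ↔ a + b = 3 := by decide
  rw [xor_eq_iff_of_lt_two_pow (m := 2) (by norm_num),
    hmod _ (Nat.mod_lt _ (by norm_num)) _ (Nat.mod_lt _ (by norm_num))]
  omega

/-- The pairs of numbers that describe a position of the pair game: coins on two points `x > y` of
`{0, …, 2k - 1}` that are not mirror images of each other under `x ↦ 2k - 1 - x`. -/
abbrev IsCoinPair (k x y : ℕ) : Prop := y < x ∧ x < 2 * k ∧ x + y + 1 ≠ 2 * k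

/-- The positions of the pair game. -/
structure CoinPair (k : ℕ) where
  x : ℕ
  y : ℕ
  isCoinPair : IsCoinPair k x y

namespace CoinPair

variable {k : ℕ} {p : CoinPair k}

/-- The moves `(x, y) → (x', y')` of the pair game: one coin is moved to a smaller point (the larger
coin may pass the smaller one), or both coins are replaced by their mirror images, if this decreases
their sum. The pairs are understood to satisfy `IsCoinPair k`. -/
abbrev Step (k x y x' y' : ℕ) : Prop :=
  (x' < x ∧ y' = y) ∨ x' = y ∨ (x' = x ∧ y' < y) ∨
    (2 * k ≤ x + y ∧ x' + y + 1 = 2 * k ∧ y' + x + 1 = 2 * k)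

/-- The moves of the pair game, as a relation between positions. -/
def Move (p q : CoinPair k) : Prop := Step k p.x p.y q.x q.y

theorem Move.add_lt {q : CoinPair k} (h : p.Move q) : q.x + q.y < p.x + p.y := by
  have hp := p.isCoinPair
  have hq := q.isCoinPair
  rw [Move] at h
  omega

instance : Finite (CoinPair k) := by
  refine Finite.of_injective
    (fun p => ((⟨p.x, p.isCoinPair.2.1⟩, ⟨p.y, p.isCoinPair.1.trans p.isCoinPair.2.1⟩) :
      Fin (2 * k) × Fin (2 * k))) ?_
  rintro ⟨_, _⟩ ⟨_, _⟩ h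
  simpa only [Prod.mk.injEq, Fin.mk.injEq, CoinPair.mk.injEq] using h

/-- The pair game with starting position `s`. -/
def game (s : CoinPair k) : ImpartialGame where
  Pos := CoinPair k
  Move := Move
  start := s
  finite_options _ := Set.toFinite _
  wf := Subrelation.wf Move.add_lt (measure fun p : CoinPair k => p.x + p.y).wf

theorem exists_move_of_lt_x {t : ℕ} (ht : t < p.x) (hty : t ≠ p.y) (hadd : t + p.y + 1 ≠ 2 * k) :
    ∃ q, p.Move q ∧ ((q.x = t ∧ q.y = p.y) ∨ (q.x = p.y ∧ q.y = t)) := by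
  have hp := p.isCoinPair
  rcases lt_or_gt_of_ne hty with hlt | hlt
  · exact ⟨⟨p.y, t, by omega⟩, Or.inr (Or.inl rfl), Or.inr ⟨rfl, rfl⟩⟩
  · exact ⟨⟨t, p.y, by omega⟩, Or.inl ⟨ht, rfl⟩, Or.inl ⟨rfl, rfl⟩⟩

theorem exists_move_of_lt_y {t : ℕ} (ht : t < p.y) (hadd : p.x + t + 1 ≠ 2 * k) :
    ∃ q, p.Move q ∧ q.x = p.x ∧ q.y = t :=
  ⟨⟨p.x, t, ht.trans p.isCoinPair.1, p.isCoinPair.2.1, hadd⟩,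
    Or.inr (Or.inr (Or.inl ⟨rfl, ht⟩)), rfl, rfl⟩

theorem exists_move_reflect (h : 2 * k ≤ p.x + p.y) :
    ∃ q, p.Move q ∧ q.x + p.y + 1 = 2 * k ∧ q.y + p.x + 1 = 2 * k := by
  have hp := p.isCoinPair
  have hx : 2 * k - 1 - p.y + p.y + 1 = 2 * k := by omega
  have hy : 2 * k - 1 - p.x + p.x + 1 = 2 * k := by omega
  exact ⟨⟨2 * k - 1 - p.y, 2 * k - 1 - p.x, by omega⟩,
    Or.inr (Or.inr (Or.inr ⟨h, hx, hy⟩)), hx, hy⟩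

section Values

variable {s : CoinPair k}

theorem gValue_add_one_eq_xor (h : p.x + p.y < 2 * k) :
    s.game.gValue p + 1 = p.x ^^^ p.y := by
  induction p using s.game.wf.induction with
  | _ p ih =>
    have hne := p.isCoinPair.1.ne'
    have hpos : p.x ^^^ p.y ≠ 0 := mt Nat.xor_eq_zero_iff.1 hne
    suffices hval : s.game.gValue p = (p.x ^^^ p.y) - 1 by omega
    have hoption (q : CoinPair k) (hq : p.Move q) : s.game.gValue q + 1 = q.x ^^^ q.y :=
      ih q hq (hq.add_lt.trans h)
    refine ImpartialGame.gValue_eq_iff.2 ⟨fun q hq hval => ?_, fun u hu => ?_⟩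
    · have hxor : q.x ^^^ q.y = p.x ^^^ p.y := by rw [← hoption q hq]; omega
      have hadd := hq.add_lt
      rcases hq with ⟨hx, hy⟩ | hx | ⟨hx, hy⟩ | ⟨hle, -⟩
      · rw [hy, Nat.xor_left_inj] at hxor
        omega
      · rw [hx, Nat.xor_comm p.x, Nat.xor_right_inj] at hxor
        omega
      · rw [hx, Nat.xor_right_inj] at hxor
        omega
      · omega
    · rcases Nat.lt_xor_cases (show u + 1 < p.x ^^^ p.y by omega) with ht | ht
      · have hty : u + 1 ^^^ p.y ≠ p.y := fun heq =>
          u.succ_ne_zero (Nat.xor_left_inj.1 (heq.trans (Nat.zero_xor _).symm))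
        obtain ⟨q, hq, ⟨hx, hy⟩ | ⟨hx, hy⟩⟩ := exists_move_of_lt_x ht hty (by omega)
        all_goals
          refine ⟨q, hq, Nat.succ_injective ((hoption q hq).trans ?_)⟩
          rw [hx, hy]
        · exact Nat.xor_xor_cancel_right _ _
        · rw [Nat.xor_comm, Nat.xor_xor_cancel_right]
      · obtain ⟨q, hq, hx, hy⟩ := exists_move_of_lt_y ht (by omega)
        refine ⟨q, hq, Nat.succ_injective ((hoption q hq).trans ?_)⟩
        rw [hx, hy, Nat.xor_comm, Nat.xor_xor_cancel_right]

theorem gValue_eq_iff_xor {v : ℕ} (h : p.x + p.y < 2 * k) :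
    s.game.gValue p = v ↔ p.x ^^^ p.y = v + 1 := by
  rw [← gValue_add_one_eq_xor (s := s) h, Nat.add_right_cancel_iff]

theorem gValue_eq_iff_of_kernel {v : ℕ} {S : ℕ → ℕ → Prop}
    (hlow : ∀ p : CoinPair k, p.x + p.y < 2 * k → (p.x ^^^ p.y = v + 1 ↔ S p.x p.y))
    (hle : ∀ p : CoinPair k, 2 * k ≤ p.x + p.y → S p.x p.y → v ≤ s.game.gValue p)
    (hindep : ∀ p q : CoinPair k, 2 * k ≤ p.x + p.y → S p.x p.y → p.Move q → ¬S q.x q.y)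
    (habs : ∀ p : CoinPair k, 2 * k ≤ p.x + p.y → ¬S p.x p.y → v ≤ s.game.gValue p →
      ∃ x y, IsCoinPair k x y ∧ Step k p.x p.y x y ∧ S x y) (p : CoinPair k) :
    s.game.gValue p = v ↔ S p.x p.y := by
  refine ImpartialGame.gValue_eq_iff_mem_of_kernel (G := s.game)
    (L := {p : CoinPair k | p.x + p.y < 2 * k}) (S := {p : CoinPair k | S p.x p.y})
    (fun p hp => (gValue_eq_iff_xor hp).trans (hlow p hp))
    (fun p hp => hle p (not_lt.1 hp))
    (fun p hp hS q hq => hindep p q (not_lt.1 hp) hS hq)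
    (fun p hp hS hv => ?_) p
  obtain ⟨x, y, hxy, hstep, hS⟩ := habs p (not_lt.1 hp) hS hv
  exact ⟨⟨x, y, hxy⟩, hstep, hS⟩

end Values

/-- The positions of value `0`. -/
abbrev ValueZero (k x y : ℕ) : Prop :=
  (x + y < 2 * k ∧ x = y + 1 ∧ y % 2 = 0) ∨
    (2 * k ≤ x + y ∧ x = y + 2 ∧ (y % 4 < 2 ↔ k % 4 < 2))

/-- The positions of value `1`. -/
abbrev ValueOne (k x y : ℕ) : Prop :=
  (x + y < 2 * k ∧ x = y + 2 ∧ y % 4 < 2) ∨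
    (2 * k ≤ x + y ∧
      (((k % 4 = 0 ∨ k % 4 = 3) ∧ x = y + 1 ∧ y % 2 = 0) ∨
        (k % 4 = 1 ∧ ((x = y + 1 ∧ y % 2 = 0 ∧ k + 3 ≤ y) ∨ (x = k + 2 ∧ y + 1 = k) ∨
          (x = k + 1 ∧ y = k))) ∨
        (k % 4 = 2 ∧ x = y + 3 ∧ y % 2 = 1)))

/-- The positions of value `2` for `k % 4 = 2`, the only case in which they are needed. -/
abbrev ValueTwo (k x y : ℕ) : Prop :=
  (x + y < 2 * k ∧ ((x = y + 3 ∧ y % 4 = 0) ∨ (x = y + 1 ∧ y % 4 = 1))) ∨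
    (2 * k ≤ x + y ∧ ((x = y + 1 ∧ y % 2 = 0 ∧ k + 4 ≤ y) ∨ (x = k + 3 ∧ y = k) ∨
      (x = k + 2 ∧ y + 2 = k) ∨ (x = k + 1 ∧ y + 1 = k)))

section Kernels

variable {x y : ℕ}

theorem exists_step_valueZero (hxy : IsCoinPair k x y) (hk : 2 * k ≤ x + y)
    (h0 : ¬ValueZero k x y) :
    ∃ x' y', IsCoinPair k x' y' ∧ Step k x y x' y' ∧ ValueZero k x' y' := by
  rcases Nat.mod_two_eq_zero_or_one y with heven | hodd
  · by_cases hlow : y + 1 < k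
    · exact ⟨y + 1, y, by grind⟩
    by_cases hclass : y % 4 < 2 ↔ k % 4 < 2
    · rcases lt_or_ge (y + 2) x with hgap | hgap
      · exact ⟨y + 2, y, by grind⟩
      · exact ⟨2 * k - 1 - y, 2 * k - 1 - x, by grind⟩
    · exact ⟨y, y - 2, by grind⟩
  · by_cases hlow : y < k
    · exact ⟨y, y - 1, by grind⟩
    by_cases hclass : y % 4 < 2 ↔ k % 4 < 2
    · rcases lt_or_ge (y + 2) x with hgap | hgap
      · exact ⟨y + 2, y, by grind⟩
      · exact ⟨x, y - 1, by grind⟩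
    · exact ⟨y, y - 2, by grind⟩

theorem exists_step_valueOne_of_lt (hxy : IsCoinPair k x y) (hk : 2 * k ≤ x + y)
    (hy : (y % 4 < 2 ∧ y + 1 < k) ∨ (2 ≤ y % 4 ∧ y ≤ k)) :
    ∃ x' y', IsCoinPair k x' y' ∧ Step k x y x' y' ∧ ValueOne k x' y' := by
  rcases hy with ⟨hclass, hlow⟩ | ⟨hclass, hlow⟩
  · exact ⟨y + 2, y, by grind⟩
  · exact ⟨y, y - 2, by grind⟩

theorem exists_step_valueOne_of_mod_eq_zero_or_three (hmod : k % 4 = 0 ∨ k % 4 = 3)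
    (hxy : IsCoinPair k x y) (hk : 2 * k ≤ x + y) (h1 : ¬ValueOne k x y) :
    ∃ x' y', IsCoinPair k x' y' ∧ Step k x y x' y' ∧ ValueOne k x' y' := by
  by_cases hlow : (y % 4 < 2 ∧ y + 1 < k) ∨ (2 ≤ y % 4 ∧ y ≤ k)
  · exact exists_step_valueOne_of_lt hxy hk hlow
  rcases Nat.mod_two_eq_zero_or_one y with heven | hodd
  · exact ⟨y + 1, y, by grind⟩
  · exact ⟨y, y - 1, by grind⟩

theorem exists_step_valueOne_of_mod_eq_one (hmod : k % 4 = 1)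
    (hxy : IsCoinPair k x y) (hk : 2 * k ≤ x + y) (h0 : ¬ValueZero k x y)
    (h1 : ¬ValueOne k x y) :
    ∃ x' y', IsCoinPair k x' y' ∧ Step k x y x' y' ∧ ValueOne k x' y' := by
  by_cases hlow : (y % 4 < 2 ∧ y + 1 < k) ∨ (2 ≤ y % 4 ∧ y ≤ k)
  · exact exists_step_valueOne_of_lt hxy hk hlow
  obtain hy | hy | hy | hy | hy : y + 1 = k ∨ y = k ∨ y = k + 1 ∨ y = k + 2 ∨ k + 3 ≤ y := by
    omega
  · exact ⟨k + 2, y, by grind⟩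
  · exact ⟨k + 1, y, by grind⟩
  · exact ⟨y, k, by grind⟩
  · exact ⟨y, k - 1, by grind⟩
  · rcases Nat.mod_two_eq_zero_or_one y with heven | hodd
    · exact ⟨y + 1, y, by grind⟩
    · exact ⟨y, y - 1, by grind⟩

theorem exists_step_valueOne_of_mod_eq_two (hmod : k % 4 = 2)
    (hxy : IsCoinPair k x y) (hk : 2 * k ≤ x + y) (h0 : ¬ValueZero k x y)
    (h1 : ¬ValueOne k x y) :
    ∃ x' y', IsCoinPair k x' y' ∧ Step k x y x' y' ∧ ValueOne k x' y' := by
  by_cases hlow : (y % 4 < 2 ∧ y + 1 < k) ∨ (2 ≤ y % 4 ∧ y ≤ k)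
  · exact exists_step_valueOne_of_lt hxy hk hlow
  rcases Nat.mod_two_eq_zero_or_one y with heven | hodd
  · exact ⟨y, y - 3, by grind⟩
  · obtain hgap | hgap | hgap : y + 3 < x ∨ x = y + 2 ∨ x = y + 1 := by omega
    · exact ⟨y + 3, y, by grind⟩
    · exact ⟨2 * k - 1 - y, 2 * k - 1 - x, by omega, by omega, by grind⟩
    · exact ⟨x, y - 2, by grind⟩

theorem exists_step_valueTwo (hmod : k % 4 = 2) (hxy : IsCoinPair k x y) (hk : 2 * k ≤ x + y)
    (h0 : ¬ValueZero k x y) (h2 : ¬ValueTwo k x y) :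
    ∃ x' y', IsCoinPair k x' y' ∧ Step k x y x' y' ∧ ValueTwo k x' y' := by
  obtain hy | hy | hy | hy | hy | hy | hy | hy :
    y + 2 < k ∨ y + 2 = k ∨ y + 1 = k ∨ y = k ∨ y = k + 1 ∨ y = k + 2 ∨ y = k + 3 ∨ k + 4 ≤ y := by
    omega
  · obtain hclass | hclass | hclass | hclass :
      y % 4 = 0 ∨ y % 4 = 1 ∨ y % 4 = 2 ∨ y % 4 = 3 := by omega
    · exact ⟨y + 3, y, by grind⟩
    · exact ⟨y + 1, y, by grind⟩
    · exact ⟨y, y - 1, by grind⟩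
    · exact ⟨y, y - 3, by grind⟩
  · exact ⟨k + 2, y, by grind⟩
  · exact ⟨k + 1, y, by grind⟩
  · rcases lt_or_ge (k + 3) x with hgap | hgap
    · exact ⟨k + 3, y, by grind⟩
    · exact ⟨x, k - 1, by grind⟩
  · exact ⟨y, k - 1, by grind⟩
  · exact ⟨y, k - 2, by grind⟩
  · exact ⟨y, k, by grind⟩
  · rcases Nat.mod_two_eq_zero_or_one y with heven | hodd
    · exact ⟨y + 1, y, by grind⟩
    · exact ⟨y, y - 1, by grind⟩

theorem exists_step_valueOne (hxy : IsCoinPair k x y) (hk : 2 * k ≤ x + y)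
    (h0 : ¬ValueZero k x y) (h1 : ¬ValueOne k x y) :
    ∃ x' y', IsCoinPair k x' y' ∧ Step k x y x' y' ∧ ValueOne k x' y' := by
  obtain hmod | hmod | hmod : (k % 4 = 0 ∨ k % 4 = 3) ∨ k % 4 = 1 ∨ k % 4 = 2 := by omega
  · exact exists_step_valueOne_of_mod_eq_zero_or_three hmod hxy hk h1
  · exact exists_step_valueOne_of_mod_eq_one hmod hxy hk h0 h1
  · exact exists_step_valueOne_of_mod_eq_two hmod hxy hk h0 h1

end Kernels

section Values

variable {s : CoinPair k}

theorem gValue_eq_zero_iff (p : CoinPair k) : s.game.gValue p = 0 ↔ ValueZero k p.x p.y := by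
  refine gValue_eq_iff_of_kernel (fun p hp => ?_) (fun p _ _ => Nat.zero_le _)
    (fun p q hp hS hmove => ?_)
    (fun p hp h0 _ => exists_step_valueZero p.isCoinPair hp h0) p
  · rw [xor_eq_one_iff p.isCoinPair.1]
    omega
  · have hpair := q.isCoinPair
    rw [Move] at hmove
    grind

theorem gValue_eq_one_iff (p : CoinPair k) : s.game.gValue p = 1 ↔ ValueOne k p.x p.y := by
  refine gValue_eq_iff_of_kernel (fun p hp => ?_) (fun p hp h1 => ?_)
    (fun p q hp hS hmove => ?_) (fun p hp h1 hv => ?_) p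
  · rw [xor_eq_two_iff p.isCoinPair.1]
    omega
  · rw [Nat.one_le_iff_ne_zero, Ne, gValue_eq_zero_iff]
    grind
  · have hpair := q.isCoinPair
    rw [Move] at hmove
    grind
  · rw [Nat.one_le_iff_ne_zero, Ne, gValue_eq_zero_iff] at hv
    exact exists_step_valueOne p.isCoinPair hp hv h1

theorem gValue_eq_two_iff (hk : k % 4 = 2) (p : CoinPair k) :
    s.game.gValue p = 2 ↔ ValueTwo k p.x p.y := by
  have two_le_iff (p : CoinPair k) :
      2 ≤ s.game.gValue p ↔ ¬ValueZero k p.x p.y ∧ ¬ValueOne k p.x p.y := by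
    rw [← gValue_eq_zero_iff (s := s), ← gValue_eq_one_iff (s := s)]
    omega
  refine gValue_eq_iff_of_kernel (fun p hp => ?_) (fun p hp h2 => ?_)
    (fun p q hp hS hmove => ?_)
    (fun p hp h2 hv => exists_step_valueTwo hk p.isCoinPair hp ((two_le_iff p).1 hv).1 h2) p
  · rw [xor_eq_three_iff p.isCoinPair.1]
    omega
  · rw [two_le_iff]
    constructor <;> grind
  · have hpair := q.isCoinPair
    rw [Move] at hmove
    grind

theorem gValue_top_two {s p : CoinPair 2} (hx : p.x = 3) (hy : p.y = 2) :
    s.game.gValue p = 3 := by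
  have hne0 : s.game.gValue p ≠ 0 := by rw [Ne, gValue_eq_zero_iff, hx, hy]; decide
  have hne1 : s.game.gValue p ≠ 1 := by rw [Ne, gValue_eq_one_iff, hx, hy]; decide
  have hne2 : s.game.gValue p ≠ 2 := by rw [Ne, gValue_eq_two_iff rfl, hx, hy]; decide
  refine le_antisymm (not_lt.1 fun hlt => ?_) (by omega)
  obtain ⟨(q : CoinPair 2), hmove, hq⟩ := ImpartialGame.exists_move_gValue_eq hlt
  have hadd := Move.add_lt hmove
  have hpair := q.isCoinPair
  obtain ⟨hqx, hqy⟩ | ⟨hqx, hqy⟩ | ⟨hqx, hqy⟩ :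
    q.x = 1 ∧ q.y = 0 ∨ q.x = 2 ∧ q.y = 0 ∨ q.x = 3 ∧ q.y = 1 := by omega
  · have hq0 : s.game.gValue q = 0 := by rw [gValue_eq_zero_iff, hqx, hqy]; decide
    omega
  · have hq1 : s.game.gValue q = 1 := by rw [gValue_eq_one_iff, hqx, hqy]; decide
    omega
  · have hq2 : s.game.gValue q = 2 := by rw [gValue_eq_two_iff rfl, hqx, hqy]; decide
    omega

theorem gValue_top (hk : 2 ≤ k) {p : CoinPair k} (hx : p.x = 2 * k - 1) (hy : p.y = 2 * k - 2) :
    s.game.gValue p = if k = 2 then 3 else if k % 4 = 2 then 2 else 1 := by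
  split_ifs with htwo hmod
  · subst htwo
    exact gValue_top_two hx hy
  · rw [gValue_eq_two_iff hmod]
    exact Or.inr ⟨by omega, Or.inl (by omega)⟩
  · rw [gValue_eq_one_iff]
    exact Or.inr ⟨by omega, by grind⟩

end Values

end CoinPair

namespace HookGame

/-! ### From two-row diagrams to coin pairs -/

/-- The increasing enumeration of the natural numbers other than `(n + 1) / 2`, the fixed point of
`x ↦ n + 1 - x`, which exists only for odd `n`. -/
def skipCentre (n x : ℕ) : ℕ := if x ≤ n / 2 then x else x + n % 2

section Translation

variable {n x y : ℕ}

theorem skipCentre_lt_iff : skipCentre n x < skipCentre n y ↔ x < y := by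
  grind [skipCentre]

theorem skipCentre_add_eq_iff :
    skipCentre n x + skipCentre n y = n + 1 ↔ x + y + 1 = 2 * (n / 2 + 1) := by
  grind [skipCentre]

theorem sub_skipCentre (h : x + y + 1 = 2 * (n / 2 + 1)) :
    n + 1 - skipCentre n y = skipCentre n x := by
  rw [← skipCentre_add_eq_iff.2 h, Nat.add_sub_cancel]

theorem lt_skipCentre_add_iff :
    n + 1 < skipCentre n x + skipCentre n y ↔ 2 * (n / 2 + 1) ≤ x + y := by
  grind [skipCentre]

theorem two_mul_skipCentre_ne (n x : ℕ) : 2 * skipCentre n x ≠ n + 1 := by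
  grind [skipCentre]

theorem skipCentre_le_iff : skipCentre n x ≤ n + 1 ↔ x < 2 * (n / 2 + 1) := by
  grind [skipCentre]

theorem exists_skipCentre_eq {z : ℕ} (hz : 2 * z ≠ n + 1) : ∃ x, skipCentre n x = z := by
  by_cases h : z ≤ n / 2
  · exact ⟨z, if_pos h⟩
  · exact ⟨z - n % 2, by grind [skipCentre]⟩

theorem admissible_skipCentre_iff : Admissible (n + 1) (skipCentre n x) (skipCentre n y) ↔
    x ≠ y ∧ x < 2 * (n / 2 + 1) ∧ y < 2 * (n / 2 + 1) ∧ x + y + 1 ≠ 2 * (n / 2 + 1) := by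
  have hne : skipCentre n x ≠ skipCentre n y ↔ x ≠ y := by
    rw [← lt_or_lt_iff_ne, ← lt_or_lt_iff_ne, skipCentre_lt_iff, skipCentre_lt_iff]
  simp only [Admissible, hne, skipCentre_le_iff, ne_eq, skipCentre_add_eq_iff,
    two_mul_skipCentre_ne, not_false_eq_true, and_true]

/-- The two-row diagram that a pair of coins stands for. -/
def pairDiagram (n : ℕ) (p : CoinPair (n / 2 + 1)) : YoungDiagram :=
  twoRow (skipCentre n p.x) (skipCentre n p.y)

theorem admissible_pair (p : CoinPair (n / 2 + 1)) :
    Admissible (n + 1) (skipCentre n p.x) (skipCentre n p.y) :=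
  admissible_skipCentre_iff.2 ⟨p.isCoinPair.1.ne', p.isCoinPair.2.1,
    p.isCoinPair.1.trans p.isCoinPair.2.1, p.isCoinPair.2.2⟩

theorem turn_pairDiagram_iff {p : CoinPair (n / 2 + 1)} {Z : YoungDiagram} :
    Turn (unimodal 2 n) (pairDiagram n p) Z ↔ ∃ q, p.Move q ∧ Z = pairDiagram n q := by
  rw [pairDiagram, turn_twoRow_iff (admissible_pair p)]
  constructor
  · rintro (⟨z, hz, hadm, rfl⟩ | ⟨z, hz, hadm, rfl⟩ | ⟨hlt, rfl⟩)
    · obtain ⟨t, rfl⟩ := exists_skipCentre_eq hadm.2.2.2.2.1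
      obtain ⟨hty, -, -, hadd⟩ := admissible_skipCentre_iff.1 hadm
      obtain ⟨q, hq, ⟨hx, hy⟩ | ⟨hx, hy⟩⟩ :=
        CoinPair.exists_move_of_lt_x (skipCentre_lt_iff.1 hz) hty hadd
      · exact ⟨q, hq, by rw [pairDiagram, hx, hy]⟩
      · exact ⟨q, hq, by rw [pairDiagram, hx, hy, twoRow_comm]⟩
    · obtain ⟨t, rfl⟩ := exists_skipCentre_eq hadm.2.2.2.2.2
      obtain ⟨q, hq, hx, hy⟩ := CoinPair.exists_move_of_lt_y (skipCentre_lt_iff.1 hz)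
        (admissible_skipCentre_iff.1 hadm).2.2.2
      exact ⟨q, hq, by rw [pairDiagram, hx, hy]⟩
    · obtain ⟨q, hq, hx, hy⟩ := CoinPair.exists_move_reflect (lt_skipCentre_add_iff.1 hlt)
      exact ⟨q, hq, by rw [pairDiagram, twoRow_comm, sub_skipCentre hx, sub_skipCentre hy]⟩
  · rintro ⟨q, hq, rfl⟩
    have hadm := admissible_pair q
    rcases hq with ⟨hx, hy⟩ | hx | ⟨hx, hy⟩ | ⟨hle, hx, hy⟩
    · rw [hy] at hadm
      exact Or.inl ⟨_, skipCentre_lt_iff.2 hx, hadm, by rw [pairDiagram, hy]⟩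
    · rw [hx] at hadm
      exact Or.inl ⟨_, skipCentre_lt_iff.2 (q.isCoinPair.1.trans (hx.trans_lt p.isCoinPair.1)),
        admissible_comm.1 hadm, by rw [pairDiagram, hx, twoRow_comm]⟩
    · rw [hx] at hadm
      exact Or.inr (Or.inl ⟨_, skipCentre_lt_iff.2 hy, hadm, by rw [pairDiagram, hx]⟩)
    · exact Or.inr (Or.inr ⟨lt_skipCentre_add_iff.2 hle,
        by rw [pairDiagram, twoRow_comm, sub_skipCentre hx, sub_skipCentre hy]⟩)

theorem gValue_start_eq (s : CoinPair (n / 2 + 1)) (hs : rectangle 2 n = pairDiagram n s) :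
    (MHRG 2 n).gValue (MHRG 2 n).start = s.game.gValue s := by
  refine ImpartialGame.gValue_eq_of_bisimulation
    (fun (Y : (MHRG 2 n).Pos) (p : CoinPair (n / 2 + 1)) => Y.1 = pairDiagram n p) ?_ ?_ hs
  · intro Y p Y' hY hturn
    exact turn_pairDiagram_iff.1 (hY ▸ hturn)
  · intro Y p q hY hmove
    have hturn : Turn (unimodal 2 n) Y.1 (pairDiagram n q) :=
      hY ▸ turn_pairDiagram_iff.2 ⟨q, hmove, rfl⟩
    exact ⟨⟨pairDiagram n q, Y.2.tail hturn⟩, hturn, rfl⟩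

end Translation

end HookGame

theorem corollary4p14 (n : ℕ) (hn : 2 ≤ n) :
    (MHRG 2 n).gValue (MHRG 2 n).start =
      if n = 2 ∨ n = 3 then 3
      else if n ≡ 2 [MOD 8] ∨ n ≡ 3 [MOD 8] then 2
      else 1 := by
  let top : CoinPair (n / 2 + 1) := ⟨2 * (n / 2 + 1) - 1, 2 * (n / 2 + 1) - 2, by omega⟩
  have hstart : HookGame.rectangle 2 n = HookGame.pairDiagram n top := by
    rw [HookGame.rectangle_two_eq_twoRow, HookGame.pairDiagram]
    congr 1 <;> grind [HookGame.skipCentre]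
  have htwo : n / 2 + 1 = 2 ↔ n = 2 ∨ n = 3 := by omega
  have hmod : (n / 2 + 1) % 4 = 2 ↔ n ≡ 2 [MOD 8] ∨ n ≡ 3 [MOD 8] := by
    unfold Nat.ModEq
    omega
  rw [HookGame.gValue_start_eq top hstart, CoinPair.gValue_top (by omega) rfl rfl]
  simp only [htwo, hmod]
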